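/- An arrangement in $\mathbb R^n$ is a finite nonempty set $\mathcal A$ of linear hyperplanes (codimension-one linear subspaces). Its span $\mathrm{Span}(\mathcal A)$ is the linear span of the normal vectors of its hyperplanes, its rank is $\dim \mathrm{Span}(\mathcal A)$, and its regions are the closures of the connected components of $\mathbb R^n\setminus\bigcup_{H\in\mathcal A}H$. For a fixed region $B$ and a region $R$ let $S(R)$ be the set of $H\in\mathcal A$ separating $R$ from $B$. The poset of regions $\mathcal P(\mathcal A,B)$ is the set of regions, with $R_1\le R_2$ if and only if $S(R_1)\subseteq S(R_2)$. Supersolvability is defined recursively: every arrangement of rank $1$ or $2$ is supersolvable, and an arrangement $\mathcal A$ of rank $d\ge 2$ is supersolvable if it is a disjoint union $\mathcal A=\mathcal A_0\uplus\mathcal A_1$ such that (i) $\mathcal A_0$ is a supersolvable arrangement of rank $d-1$ and (ii) for any two distinct $H',H''\in\mathcal A_1$ there is a unique $H\in\mathcal A_0$ with $H'\cap H''\subseteq H$. Canonical base regions are also defined recursively: every region of an arrangement of rank $1$ or $2$ is canonical, and for a disjoint union $\mathcal A=\mathcal A_0\uplus\mathcal A_1$ satisfying (i) and (ii), a region $B$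 of $\mathcal A$ is canonical if the region $B_0$ of $\mathcal A_0$ containing $B$ is a canonical base region of $\mathcal A_0$ and the regions of $\mathcal A$ contained in $B_0$ are linearly ordered in $\mathcal P(\mathcal A,B)$. **Theorem.** Let $\mathcal A$ be a supersolvable hyperplane arrangement of rank $d$ and let $B$ be a canonical base region. Then $\mathcal P(\mathcal A,B)$ has a zonotopal embedding in $\mathbb R^d$. That is, one can choose a nonzero normal vector $n_H$ for each $H\in\mathcal A$, directed so that for each region $R$ the set $S(R)$ consists of exactly those $H\in\mathcal A$ with $\langle x,n_H\rangle>0$ for every $x$ in the interior of $R$ (these vectors are determined up to positive scaling), and a basis $b_1,\dots,b_d$ of $\mathrm{Span}(\mathcal A)\cong\mathbb R^d$, such that the map $Z(R)=\sum_{H\in S(R)}n_H$ satisfies, for all regions $R_1,R_2$, $$R_1\le R_2 \iff Z_i(R_1)\le Z_i(R_2)\ \text{ for all } i=1,\dots,d,$$ where $Z_i(R)$ is the coefficient of $b_i$ in the expansion of $Z(R)$ in the basis $b_1,\dots,b_d$. In particular $Z$, in these coordinates, is an order embedding of $\mathcal P(\mathcal A,B)$ into $\mathbb R^d$ with the componentwise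 order. -/

import Mathlib

/-- A central hyperplane arrangement in `ℝⁿ`: a finite, nonempty collection of linear subspaces of
codimension one. -/
structure Arrangement (n : ℕ) where
  hyperplanes : Finset (Submodule ℝ (EuclideanSpace ℝ (Fin n)))
  nonempty : hyperplanes.Nonempty
  codim_one : ∀ H ∈ hyperplanes, Module.finrank ℝ H + 1 = n

namespace Arrangement

variable {n : ℕ}

/-- The linear span of the normal vectors of the hyperplanes of `A`. -/
def Span (A : Arrangement n) : Submodule ℝ (EuclideanSpace ℝ (Fin n)) :=
  Submodule.span ℝ {v | ∃ H ∈ A.hyperplanes, v ∈ Hᗮ}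

/-- The rank of `A` is the dimension of its span. -/
noncomputable def rank (A : Arrangement n) : ℕ :=
  Module.finrank ℝ A.Span

/-- The complement of the union of the hyperplanes. -/
def complement (A : Arrangement n) : Set (EuclideanSpace ℝ (Fin n)) :=
  (⋃ H ∈ A.hyperplanes, (H : Set (EuclideanSpace ℝ (Fin n))))ᶜ

/-- A region is the closure of a connected component of the complement. -/
def IsRegion (A : Arrangement n) (R : Set (EuclideanSpace ℝ (Fin n))) : Prop :=
  ∃ x ∈ A.complement, R = closure (connectedComponentIn A.complement x)

/-- The regions of `A`. -/
def Region (A : Arrangement n) : Type :=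
  {R : Set (EuclideanSpace ℝ (Fin n)) // A.IsRegion R}

/-- `H` separates `R` from `R'`: their interiors lie strictly on opposite sides of `H`. -/
def Separates (H : Submodule ℝ (EuclideanSpace ℝ (Fin n)))
    (R R' : Set (EuclideanSpace ℝ (Fin n))) : Prop :=
  ∃ v ∈ Hᗮ, (∀ x ∈ interior R, 0 < inner ℝ v x) ∧ ∀ y ∈ interior R', inner ℝ v y < 0

open Classical in
/-- The set of hyperplanes of `A` that separate `R` from `R'`. With `R' = B` the base region, this
is the separating set of `R`. -/
noncomputable def separatingSet (A : Arrangement n) (R R' : A.Region) :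
    Finset (Submodule ℝ (EuclideanSpace ℝ (Fin n))) :=
  A.hyperplanes.filter fun H => Separates H R.1 R'.1

theorem mem_of_mem_separatingSet (A : Arrangement n) {R R' : A.Region}
    {H : Submodule ℝ (EuclideanSpace ℝ (Fin n))} (h : H ∈ A.separatingSet R R') :
    H ∈ A.hyperplanes := by
  classical
  exact (Finset.mem_filter.mp h).1

/-- The regions of `A`, to be ordered with respect to the base region `B`. -/
def RegionPoset (A : Arrangement n) (_B : A.Region) : Type :=
  A.Region

/-! Facts needed for the antisymmetry of the poset of regions. -/

theorem exists_normal (A : Arrangement n) {H : Submodule ℝ (EuclideanSpace ℝ (Fin n))}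
    (hH : H ∈ A.hyperplanes) :
    ∃ v ∈ Hᗮ, (∀ w ∈ Hᗮ, ∃ c : ℝ, c • v = w) ∧ ∀ x, x ∈ H ↔ inner ℝ v x = 0 := by
  have h1 : Module.finrank ℝ Hᗮ = 1 := by
    have h := Submodule.finrank_add_finrank_orthogonal H
    have h' := A.codim_one H hH
    simp only [finrank_euclideanSpace, Fintype.card_fin] at h
    omega
  obtain ⟨v, -, hv⟩ := finrank_eq_one_iff'.mp h1
  have hall : ∀ w ∈ Hᗮ, ∃ c : ℝ, c • (v : EuclideanSpace ℝ (Fin n)) = w := by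
    intro w hw
    obtain ⟨c, hc⟩ := hv ⟨w, hw⟩
    exact ⟨c, by simpa using congrArg Subtype.val hc⟩
  refine ⟨v, v.2, hall, fun x => ⟨fun hx => ?_, fun hx => ?_⟩⟩
  · exact (Submodule.mem_orthogonal' H _).mp v.2 x hx
  · rw [← Submodule.orthogonal_orthogonal H, Submodule.mem_orthogonal]
    intro w hw
    obtain ⟨c, rfl⟩ := hall w hw
    rw [inner_smul_left, hx, mul_zero]

theorem isOpen_complement (A : Arrangement n) : IsOpen A.complement := by
  refine IsClosed.isOpen_compl (self := ?_)
  exact A.hyperplanes.finite_toSet.isClosed_biUnion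
    fun H _ => Submodule.closed_of_finiteDimensional H

theorem component_subset_interior (A : Arrangement n) (x : EuclideanSpace ℝ (Fin n)) :
    connectedComponentIn A.complement x ⊆
      interior (closure (connectedComponentIn A.complement x)) :=
  interior_maximal subset_closure A.isOpen_complement.connectedComponentIn

/-- A linear functional that is nonnegative on a set is positive on its interior. -/
theorem inner_pos_of_interior {s : Set (EuclideanSpace ℝ (Fin n))}
    {v : EuclideanSpace ℝ (Fin n)} (hv : v ≠ 0) (h : ∀ x ∈ s, 0 ≤ inner ℝ v x) :
    ∀ x ∈ interior s, 0 < inner ℝ v x := by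
  intro x hx
  have hc : Filter.Tendsto (fun t : ℝ => x - t • v) (nhdsWithin 0 (Set.Ioi 0)) (nhds x) := by
    have : Continuous fun t : ℝ => x - t • v := by fun_prop
    have h0 := this.tendsto 0
    simp only [zero_smul, sub_zero] at h0
    exact h0.mono_left nhdsWithin_le_nhds
  have hs : s ∈ nhds x := mem_interior_iff_mem_nhds.mp hx
  obtain ⟨t, ht, ht0⟩ := ((hc.eventually hs).and self_mem_nhdsWithin).exists
  have h1 := h _ ht
  rw [inner_sub_right, inner_smul_right] at h1
  have h2 : 0 < inner ℝ v v := real_inner_self_pos.mpr hv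
  have h3 : 0 < t * inner ℝ v v := mul_pos ht0 h2
  linarith

theorem normal_side (A : Arrangement n) {H : Submodule ℝ (EuclideanSpace ℝ (Fin n))}
    (hH : H ∈ A.hyperplanes) {v : EuclideanSpace ℝ (Fin n)}
    (hvH : ∀ x, x ∈ H ↔ inner ℝ v x = 0) (x : EuclideanSpace ℝ (Fin n))
    (hx : x ∈ A.complement) (hpos : 0 < inner ℝ v x) :
    ∀ y ∈ interior (closure (connectedComponentIn A.complement x)), 0 < inner ℝ v y := by
  have hv : v ≠ 0 := by
    rintro rfl
    simp at hpos
  refine inner_pos_of_interior hv ?_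
  have hcl : IsClosed {y : EuclideanSpace ℝ (Fin n) | 0 ≤ inner ℝ v y} :=
    isClosed_le continuous_const (by fun_prop)
  refine closure_minimal (fun y hy => ?_) hcl
  by_contra hneg
  have hpc : IsPreconnected (connectedComponentIn A.complement x) :=
    isPreconnected_connectedComponentIn
  have hcont : ContinuousOn (fun z => inner ℝ v z) (connectedComponentIn A.complement x) := by
    fun_prop
  have hlt : inner ℝ v y < 0 := not_le.mp hneg
  obtain ⟨z, hz, hz0⟩ := hpc.intermediate_value hy (mem_connectedComponentIn hx) hcont
    ⟨hlt.le, hpos.le⟩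
  have hzc := connectedComponentIn_subset _ _ hz
  exact hzc (Set.mem_biUnion hH ((hvH z).mpr hz0))

theorem separates_iff (A : Arrangement n) {H : Submodule ℝ (EuclideanSpace ℝ (Fin n))}
    (hH : H ∈ A.hyperplanes) {v : EuclideanSpace ℝ (Fin n)} (hv : v ∈ Hᗮ)
    (hall : ∀ w ∈ Hᗮ, ∃ c : ℝ, c • v = w) (hvH : ∀ x, x ∈ H ↔ inner ℝ v x = 0)
    {x y : EuclideanSpace ℝ (Fin n)} (hx : x ∈ A.complement) (hy : y ∈ A.complement) :
    Separates H (closure (connectedComponentIn A.complement x))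
      (closure (connectedComponentIn A.complement y)) ↔ inner ℝ v x * inner ℝ v y < 0 := by
  have hvH' : ∀ z, z ∈ H ↔ inner ℝ (-v) z = 0 := by
    intro z
    rw [hvH, inner_neg_left, neg_eq_zero]
  constructor
  · rintro ⟨w, hw, h1, h2⟩
    obtain ⟨c, rfl⟩ := hall w hw
    have h1 := h1 x (A.component_subset_interior x (mem_connectedComponentIn hx))
    have h2 := h2 y (A.component_subset_interior y (mem_connectedComponentIn hy))
    rw [real_inner_smul_left] at h1 h2
    have h3 := mul_neg_of_pos_of_neg h1 h2
    by_contra h4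
    nlinarith [mul_nonneg (sq_nonneg c) (not_lt.mp h4)]
  · intro h
    rcases mul_neg_iff.mp h with ⟨hp, hn⟩ | ⟨hn, hp⟩
    · refine ⟨v, hv, A.normal_side hH hvH x hx hp, fun z hz => ?_⟩
      have := A.normal_side hH hvH' y hy (by rw [inner_neg_left]; linarith) z hz
      rw [inner_neg_left] at this
      linarith
    · refine ⟨-v, neg_mem hv,
        A.normal_side hH hvH' x hx (by rw [inner_neg_left]; linarith), fun z hz => ?_⟩
      have := A.normal_side hH hvH y hy hp z hz
      rw [inner_neg_left]
      linarith

theorem eq_of_separatingSet_eq (A : Arrangement n) (B R R' : A.Region)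
    (h : A.separatingSet R B = A.separatingSet R' B) : R = R' := by
  obtain ⟨B, b, hb, rfl⟩ := B
  obtain ⟨R, x, hx, rfl⟩ := R
  obtain ⟨R', y, hy, rfl⟩ := R'
  have hseg : segment ℝ x y ⊆ A.complement := by
    intro z hz hzU
    obtain ⟨H, hH, hzH⟩ := Set.mem_iUnion₂.mp hzU
    obtain ⟨v, hv, hall, hvH⟩ := A.exists_normal hH
    have hne : ∀ u ∈ A.complement, inner ℝ v u ≠ 0 := fun u hu h0 =>
      hu (Set.mem_biUnion hH ((hvH u).mpr h0))
    have hiff : inner ℝ v x * inner ℝ v b < 0 ↔ inner ℝ v y * inner ℝ v b < 0 := by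
      rw [← A.separates_iff hH hv hall hvH hx hb, ← A.separates_iff hH hv hall hvH hy hb]
      have := Finset.ext_iff.mp h H
      simpa [separatingSet, hH] using this
    have hz0 : inner ℝ v z = 0 := (hvH z).mp hzH
    obtain ⟨s, t, hs, ht, hst, rfl⟩ := hz
    rw [inner_add_right, real_inner_smul_right, real_inner_smul_right] at hz0
    rcases lt_or_gt_of_ne (hne x hx) with hx' | hx' <;>
      rcases lt_or_gt_of_ne (hne y hy) with hy' | hy' <;>
      rcases lt_or_gt_of_ne (hne b hb) with hb' | hb'
    all_goals first
      | (have := hiff.mp (by nlinarith); nlinarith)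
      | (have := hiff.mpr (by nlinarith); nlinarith)
      | (rcases hs.eq_or_lt with rfl | hs
         · have : t = 1 := by linarith
           subst this
           linarith
         · nlinarith)
  have hy' : y ∈ connectedComponentIn A.complement x :=
    (convex_segment x y).isPreconnected.subset_connectedComponentIn (left_mem_segment ℝ x y) hseg
      (right_mem_segment ℝ x y)
  exact Subtype.ext (congrArg closure (connectedComponentIn_eq hy'))

/-- The poset of regions with base region `B`: regions are ordered by inclusion of their
separating sets. -/
instance (A : Arrangement n) (B : A.Region) : PartialOrder (A.RegionPoset B) where
  le R R' := A.separatingSet R B ⊆ A.separatingSet R' B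
  le_refl _ := Finset.Subset.refl _
  le_trans _ _ _ h h' := Finset.Subset.trans h h'
  le_antisymm R R' h h' := A.eq_of_separatingSet_eq B R R' (Finset.Subset.antisymm h h')

/-- `A` is the disjoint union of an arrangement `A₀` of rank one less and a collection `A₁` such
that the intersection of any two (distinct) members of `A₁` is contained in a unique member of
`A₀`. -/
structure SplitsAs (A A₀ : Arrangement n)
    (A₁ : Finset (Submodule ℝ (EuclideanSpace ℝ (Fin n)))) : Prop where
  rank_eq : A₀.rank + 1 = A.rank
  disjoint : Disjoint A₀.hyperplanes A₁
  mem_iff : ∀ H, H ∈ A.hyperplanes ↔ H ∈ A₀.hyperplanes ∨ H ∈ A₁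
  existsUnique : ∀ H' ∈ A₁, ∀ H'' ∈ A₁, H' ≠ H'' →
    ∃! H, H ∈ A₀.hyperplanes ∧ H' ⊓ H'' ≤ H

/-- Supersolvable arrangements. -/
inductive IsSupersolvable : Arrangement n → Prop
  | of_rank_le_two (A : Arrangement n) (h : A.rank = 1 ∨ A.rank = 2) : IsSupersolvable A
  | of_splitsAs (A A₀ : Arrangement n)
      (A₁ : Finset (Submodule ℝ (EuclideanSpace ℝ (Fin n))))
      (hrank : 2 ≤ A.rank) (hA₀ : IsSupersolvable A₀) (hsplit : A.SplitsAs A₀ A₁) :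
      IsSupersolvable A

/-- Canonical base regions of supersolvable arrangements. In the second case `B₀` is the region of
`A₀` that contains `B`, and the regions of `A` inside `B₀` form a chain in the poset of regions of
`A` with base region `B`. -/
inductive IsCanonical : (A : Arrangement n) → A.Region → Prop
  | of_rank_le_two (A : Arrangement n) (B : A.Region) (h : A.rank = 1 ∨ A.rank = 2) :
      IsCanonical A B
  | of_splitsAs (A A₀ : Arrangement n)
      (A₁ : Finset (Submodule ℝ (EuclideanSpace ℝ (Fin n))))
      (hrank : 2 ≤ A.rank) (hA₀ : A₀.IsSupersolvable) (hsplit : A.SplitsAs A₀ A₁)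
      (B : A.Region) (B₀ : A₀.Region) (hB : B.1 ⊆ B₀.1) (hB₀ : IsCanonical A₀ B₀)
      (hchain : ∀ R R' : A.RegionPoset B, R.1 ⊆ B₀.1 → R'.1 ⊆ B₀.1 → R ≤ R' ∨ R' ≤ R) :
      IsCanonical A B

/-- A choice of nonzero normal vectors `n_H`, one for each hyperplane `H` of `A`, such that the
separating set of any region `R` consists of exactly those `H` for which `n_H` has positive inner
product with every point of the interior of `R`. Such a choice is unique up to positive scaling of
each vector. -/
structure NormalVectors (A : Arrangement n) (B : A.Region) where
  vec : Submodule ℝ (EuclideanSpace ℝ (Fin n)) → EuclideanSpace ℝ (Fin n)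
  mem_orthogonal : ∀ H ∈ A.hyperplanes, vec H ∈ Hᗮ
  ne_zero : ∀ H ∈ A.hyperplanes, vec H ≠ 0
  mem_separatingSet_iff : ∀ R : A.Region, ∀ H ∈ A.hyperplanes,
    H ∈ A.separatingSet R B ↔ ∀ x ∈ interior R.1, 0 < inner ℝ x (vec H)

/-- The vertex `Z(R) = ∑_{H ∈ S(R)} n_H` of the zonotope, an element of the span of `A`. -/
noncomputable def NormalVectors.Z {A : Arrangement n} {B : A.Region} (N : A.NormalVectors B)
    (R : A.RegionPoset B) : A.Span :=
  ⟨∑ H ∈ A.separatingSet R B, N.vec H, Submodule.sum_mem _ fun H hH =>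
    Submodule.subset_span ⟨H, A.mem_of_mem_separatingSet hH,
      N.mem_orthogonal H (A.mem_of_mem_separatingSet hH)⟩⟩

/-- With respect to the basis `b` of the span of `A`, the zonotope vertex map is an embedding of
the poset of regions into `ℝᵈ` with the componentwise order. -/
def IsZonotopalEmbedding {A : Arrangement n} {B : A.Region} {d : ℕ} (N : A.NormalVectors B)
    (b : Module.Basis (Fin d) ℝ A.Span) : Prop :=
  ∀ R₁ R₂ : A.RegionPoset B, R₁ ≤ R₂ ↔ ∀ i : Fin d, b.repr (N.Z R₁) i ≤ b.repr (N.Z R₂) i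

end Arrangement

/-! Induct along the splitting `A = A₀ ⊎ A₁` that witnesses canonicity. The coordinates are
functionals `⟪p i, ·⟫` nonnegative on all outward normals, so `R₁ ≤ R₂` implies the componentwise
inequality at once. All the work is in the converse, the field `reflects` of `ZonotopalData`; the
freedom to be exploited is the scaling of the normals.

Pick `u` orthogonal to `A₀.Span` and transverse to every hyperplane of `A₁`
(`SplitsAs.exists_transverse`). Two far points in opposite directions on the line through a base
point parallel to `u` lie in `B₀` and have complementary separating sets within `A₁`. As their
regions are comparable, one of these sets is empty, so after a change of sign of `u` the line meets
all of `A₁` on its positive half (`SplitsAs.exists_direction`).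

`ZonotopalData.extend` takes `u` as a new coordinate, which sees only `A₁`. The old coordinates,
shifted by a multiple of `u`, stay nonnegative. Normals of `A₁` are scaled by a tiny common factor,
so that the old coordinates still decide the order on `A₀`, and by weights that fall rapidly along
the line, so that the hyperplane met first dominates. If `x` is beyond `i` but not `j`, and `y`
beyond `j` but not `i`, the member of `A₀` through `i ⊓ j` forces `i` to be met before `j`. Hence
the new coordinate decides the order on `A₁`.

Rank one is direct, and rank two is the same extension over a single wall of the base region. -/

namespace Arrangement

variable {n : ℕ}

/-- Vectors `vec H` normal to the hyperplanes of `A` and pointing away from `B`, together with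
linear functionals `⟪p i, ·⟫` that are nonnegative on these vectors, are jointly injective on the
span of `A`, and detect the order of the poset of regions. -/
structure ZonotopalData (A : Arrangement n) (B : A.Region) (d : ℕ) where
  vec : Submodule ℝ (EuclideanSpace ℝ (Fin n)) → EuclideanSpace ℝ (Fin n)
  p : Fin d → EuclideanSpace ℝ (Fin n)
  mem_orthogonal : ∀ H ∈ A.hyperplanes, vec H ∈ Hᗮ
  neg_on_base : ∀ H ∈ A.hyperplanes, ∀ x ∈ interior B.1, inner ℝ (vec H) x < 0
  nonneg : ∀ H ∈ A.hyperplanes, ∀ i, 0 ≤ inner ℝ (p i) (vec H)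
  eq_zero : ∀ v ∈ A.Span, (∀ i, inner ℝ (p i) v = 0) → v = 0
  reflects : ∀ x ∈ A.complement, ∀ y ∈ A.complement,
    (∀ i, ∑ H ∈ A.hyperplanes with 0 < inner ℝ (vec H) x, inner ℝ (p i) (vec H) ≤
      ∑ H ∈ A.hyperplanes with 0 < inner ℝ (vec H) y, inner ℝ (p i) (vec H)) →
    ∀ H ∈ A.hyperplanes, 0 < inner ℝ (vec H) x → 0 < inner ℝ (vec H) y

/-! ### Normal vectors -/

theorem finrank_orthogonal (A : Arrangement n) {H : Submodule ℝ (EuclideanSpace ℝ (Fin n))}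
    (hH : H ∈ A.hyperplanes) : Module.finrank ℝ Hᗮ = 1 := by
  have h := Submodule.finrank_add_finrank_orthogonal H
  have h' := A.codim_one H hH
  simp only [finrank_euclideanSpace, Fintype.card_fin] at h
  omega

theorem exists_smul_eq_of_mem_orthogonal (A : Arrangement n)
    {H : Submodule ℝ (EuclideanSpace ℝ (Fin n))} (hH : H ∈ A.hyperplanes)
    {v w : EuclideanSpace ℝ (Fin n)} (hv : v ∈ Hᗮ) (hv0 : v ≠ 0) (hw : w ∈ Hᗮ) :
    ∃ c : ℝ, c • v = w := by
  obtain ⟨c, hc⟩ := exists_smul_eq_of_finrank_eq_one (A.finrank_orthogonal hH)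
    (x := (⟨v, hv⟩ : Hᗮ)) (by simpa [Subtype.ext_iff] using hv0) ⟨w, hw⟩
  exact ⟨c, by simpa using congrArg Subtype.val hc⟩

theorem mem_iff_inner_eq_zero (A : Arrangement n) {H : Submodule ℝ (EuclideanSpace ℝ (Fin n))}
    (hH : H ∈ A.hyperplanes) {v : EuclideanSpace ℝ (Fin n)} (hv : v ∈ Hᗮ) (hv0 : v ≠ 0)
    (x : EuclideanSpace ℝ (Fin n)) : x ∈ H ↔ inner ℝ v x = 0 := by
  refine ⟨fun hx => (Submodule.mem_orthogonal' H _).mp hv x hx, fun hx => ?_⟩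
  rw [← Submodule.orthogonal_orthogonal H, Submodule.mem_orthogonal]
  intro w hw
  obtain ⟨c, rfl⟩ := A.exists_smul_eq_of_mem_orthogonal hH hv hv0 hw
  rw [inner_smul_left, hx, mul_zero]

theorem inner_ne_zero (A : Arrangement n) {H : Submodule ℝ (EuclideanSpace ℝ (Fin n))}
    (hH : H ∈ A.hyperplanes) {v : EuclideanSpace ℝ (Fin n)} (hv : v ∈ Hᗮ) (hv0 : v ≠ 0)
    {x : EuclideanSpace ℝ (Fin n)} (hx : x ∈ A.complement) : inner ℝ v x ≠ 0 := fun h =>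
  hx (Set.mem_biUnion hH ((A.mem_iff_inner_eq_zero hH hv hv0 x).mpr h))

theorem mem_complement_of_inner_ne_zero (A : Arrangement n) {x : EuclideanSpace ℝ (Fin n)}
    (h : ∀ H ∈ A.hyperplanes, ∃ v ∈ Hᗮ, inner ℝ v x ≠ 0) : x ∈ A.complement := by
  intro hx
  obtain ⟨H, hH, hxH⟩ := Set.mem_iUnion₂.mp hx
  obtain ⟨v, hv, hv0⟩ := h H hH
  exact hv0 ((Submodule.mem_orthogonal' H _).mp hv x hxH)

/-- A hyperplane not containing `x` has a normal vector `v` with `⟪v, x⟫ = -1`. -/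
theorem exists_normal_inner_eq_neg_one (A : Arrangement n)
    {H : Submodule ℝ (EuclideanSpace ℝ (Fin n))} (hH : H ∈ A.hyperplanes)
    {x : EuclideanSpace ℝ (Fin n)} (hx : x ∈ A.complement) :
    ∃ v ∈ Hᗮ, inner ℝ v x = -1 := by
  obtain ⟨v, hv, -, hvH⟩ := A.exists_normal hH
  have h0 : inner ℝ v x ≠ 0 := fun h => hx (Set.mem_biUnion hH ((hvH x).mpr h))
  refine ⟨(-(inner ℝ v x)⁻¹) • v, Submodule.smul_mem _ _ hv, ?_⟩
  rw [real_inner_smul_left]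
  field_simp

theorem mem_Span (A : Arrangement n) {H : Submodule ℝ (EuclideanSpace ℝ (Fin n))}
    (hH : H ∈ A.hyperplanes) {v : EuclideanSpace ℝ (Fin n)} (hv : v ∈ Hᗮ) : v ∈ A.Span :=
  Submodule.subset_span ⟨H, hH, hv⟩

theorem Span_mono {A₀ A : Arrangement n} (h : A₀.hyperplanes ⊆ A.hyperplanes) :
    A₀.Span ≤ A.Span :=
  Submodule.span_mono fun _ ⟨H, hH, hv⟩ => ⟨H, h hH, hv⟩

theorem complement_anti {A₀ A : Arrangement n} (h : A₀.hyperplanes ⊆ A.hyperplanes) :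
    A.complement ⊆ A₀.complement :=
  Set.compl_subset_compl.mpr (Set.biUnion_subset_biUnion_left h)

theorem eq_of_mem_orthogonal (A : Arrangement n) {H H' : Submodule ℝ (EuclideanSpace ℝ (Fin n))}
    (hH : H ∈ A.hyperplanes) (hH' : H' ∈ A.hyperplanes) {v : EuclideanSpace ℝ (Fin n)}
    (hv : v ∈ Hᗮ) (hv' : v ∈ H'ᗮ) (hv0 : v ≠ 0) : H = H' := by
  ext x
  rw [A.mem_iff_inner_eq_zero hH hv hv0, A.mem_iff_inner_eq_zero hH' hv' hv0]

/-- If `H' ⊓ H'' ≤ H`, then the normals of `H` are combinations of those of `H'` and `H''`. -/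
theorem exists_combination_of_inf_le (A : Arrangement n)
    {H H' H'' : Submodule ℝ (EuclideanSpace ℝ (Fin n))} (hH' : H' ∈ A.hyperplanes)
    (hH'' : H'' ∈ A.hyperplanes) (hle : H' ⊓ H'' ≤ H) {v v' v'' : EuclideanSpace ℝ (Fin n)}
    (hv : v ∈ Hᗮ) (hv' : v' ∈ H'ᗮ) (hv0' : v' ≠ 0) (hv'' : v'' ∈ H''ᗮ) (hv0'' : v'' ≠ 0) :
    ∃ a b : ℝ, a • v' + b • v'' = v := by
  rw [← Submodule.mem_span_pair, ← Submodule.orthogonal_orthogonal (Submodule.span ℝ {v', v''})]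
  refine Submodule.orthogonal_le (fun x hx => hle ⟨?_, ?_⟩) hv
  · exact (A.mem_iff_inner_eq_zero hH' hv' hv0' x).mpr
      ((Submodule.mem_orthogonal _ _).mp hx v' (Submodule.subset_span (by simp)))
  · exact (A.mem_iff_inner_eq_zero hH'' hv'' hv0'' x).mpr
      ((Submodule.mem_orthogonal _ _).mp hx v'' (Submodule.subset_span (by simp)))

/-! ### Regions -/

theorem mem_interior_of_eq_closure {A : Arrangement n} {x : EuclideanSpace ℝ (Fin n)}
    (hx : x ∈ A.complement) : x ∈ interior (closure (connectedComponentIn A.complement x)) :=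
  A.component_subset_interior x (mem_connectedComponentIn hx)

/-- Points on the same side of every hyperplane lie in the same component. -/
theorem connectedComponentIn_eq_of_inner_mul_pos (A : Arrangement n)
    {x y : EuclideanSpace ℝ (Fin n)}
    (h : ∀ H ∈ A.hyperplanes, ∃ v ∈ Hᗮ, 0 < inner ℝ v x * inner ℝ v y) :
    connectedComponentIn A.complement x = connectedComponentIn A.complement y := by
  have hseg : segment ℝ x y ⊆ A.complement := by
    rintro z ⟨s, t, hs, ht, hst, rfl⟩
    refine A.mem_complement_of_inner_ne_zero fun H hH => ?_
    obtain ⟨v, hv, hpos⟩ := h H hH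
    refine ⟨v, hv, fun h0 => ?_⟩
    rw [inner_add_right, real_inner_smul_right, real_inner_smul_right] at h0
    have hs' : 0 < s ∨ 0 < t := by
      by_contra! hle
      linarith
    rcases pos_and_pos_or_neg_and_neg_of_mul_pos hpos with ⟨hx, hy⟩ | ⟨hx, hy⟩ <;>
      rcases hs' with hs' | ht'
    · linarith [mul_pos hs' hx, mul_nonneg ht hy.le]
    · linarith [mul_pos ht' hy, mul_nonneg hs hx.le]
    · linarith [mul_neg_of_pos_of_neg hs' hx, mul_nonpos_of_nonneg_of_nonpos ht hy.le]
    · linarith [mul_neg_of_pos_of_neg ht' hy, mul_nonpos_of_nonneg_of_nonpos hs hx.le]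
  exact connectedComponentIn_eq ((convex_segment x y).isPreconnected.subset_connectedComponentIn
    (left_mem_segment ℝ x y) hseg (right_mem_segment ℝ x y))

/-- A region is a closure, so its interior is not known a priori to be the component itself;
`normal_side` gives the constant sign on the whole interior. -/
theorem inner_mul_pos_of_mem_interior (A : Arrangement n) (R : A.Region)
    {H : Submodule ℝ (EuclideanSpace ℝ (Fin n))} (hH : H ∈ A.hyperplanes)
    {v x y : EuclideanSpace ℝ (Fin n)} (hv : v ∈ Hᗮ) (hv0 : v ≠ 0) (hx : x ∈ interior R.1)
    (hy : y ∈ interior R.1) : 0 < inner ℝ v x * inner ℝ v y := by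
  obtain ⟨R, z, hz, rfl⟩ := R
  have hv' : -v ∈ Hᗮ := neg_mem hv
  have hv0' : -v ≠ 0 := neg_ne_zero.mpr hv0
  rcases lt_or_gt_of_ne (A.inner_ne_zero hH hv hv0 hz) with h | h
  · have key := A.normal_side hH (A.mem_iff_inner_eq_zero hH hv' hv0') z hz
      (by rw [inner_neg_left]; linarith)
    have h1 := key x hx
    have h2 := key y hy
    rw [inner_neg_left] at h1 h2
    exact mul_pos_of_neg_of_neg (by linarith) (by linarith)
  · have key := A.normal_side hH (A.mem_iff_inner_eq_zero hH hv hv0) z hz h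
    exact mul_pos (key x hx) (key y hy)

/-- A region is the closure of the component of any point of the complement in its interior. -/
theorem eq_closure_of_mem_interior (A : Arrangement n) (R : A.Region)
    {x : EuclideanSpace ℝ (Fin n)} (hx : x ∈ interior R.1) :
    R.1 = closure (connectedComponentIn A.complement x) := by
  obtain ⟨z, hz, hR⟩ := R.2
  rw [hR, A.connectedComponentIn_eq_of_inner_mul_pos (x := z) (y := x)]
  intro H hH
  obtain ⟨v, hv, hvz⟩ := A.exists_normal_inner_eq_neg_one hH hz
  refine ⟨v, hv, A.inner_mul_pos_of_mem_interior R hH hv ?_ ?_ hx⟩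
  · rintro rfl
    simp at hvz
  · rw [hR]
    exact mem_interior_of_eq_closure hz

theorem exists_mem_interior (A : Arrangement n) (R : A.Region) :
    ∃ x ∈ A.complement, x ∈ interior R.1 := by
  obtain ⟨R, z, hz, rfl⟩ := R
  exact ⟨z, hz, mem_interior_of_eq_closure hz⟩

/-! ### From the data to a zonotopal embedding -/

theorem ZonotopalData.vec_ne_zero {A : Arrangement n} {B : A.Region} {d : ℕ}
    (D : A.ZonotopalData B d) {H : Submodule ℝ (EuclideanSpace ℝ (Fin n))}
    (hH : H ∈ A.hyperplanes) : D.vec H ≠ 0 := by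
  obtain ⟨b, -, hb⟩ := A.exists_mem_interior B
  intro h
  have := D.neg_on_base H hH b hb
  simp [h] at this

theorem ZonotopalData.mem_separatingSet_iff {A : Arrangement n} {B : A.Region} {d : ℕ}
    (D : A.ZonotopalData B d) (R : A.Region) {x : EuclideanSpace ℝ (Fin n)}
    (hx : x ∈ A.complement) (hxR : x ∈ interior R.1)
    {H : Submodule ℝ (EuclideanSpace ℝ (Fin n))} (hH : H ∈ A.hyperplanes) :
    H ∈ A.separatingSet R B ↔ 0 < inner ℝ (D.vec H) x := by
  classical
  obtain ⟨b, hb, hbB⟩ := A.exists_mem_interior B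
  have hv := D.mem_orthogonal H hH
  have hv0 := D.vec_ne_zero hH
  have hneg := D.neg_on_base H hH b hbB
  rw [separatingSet, Finset.mem_filter, and_iff_right hH, A.eq_closure_of_mem_interior R hxR,
    A.eq_closure_of_mem_interior B hbB, A.separates_iff hH hv
      (fun w hw => A.exists_smul_eq_of_mem_orthogonal hH hv hv0 hw)
      (A.mem_iff_inner_eq_zero hH hv hv0) hx hb]
  exact ⟨fun h => by by_contra h'; nlinarith, fun h => mul_neg_of_pos_of_neg h hneg⟩

/-- The normal vectors underlying the data. -/
def ZonotopalData.normalVectors {A : Arrangement n} {B : A.Region} {d : ℕ}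
    (D : A.ZonotopalData B d) : A.NormalVectors B where
  vec := D.vec
  mem_orthogonal := D.mem_orthogonal
  ne_zero _ hH := D.vec_ne_zero hH
  mem_separatingSet_iff R H hH := by
    obtain ⟨x, hx, hxR⟩ := A.exists_mem_interior R
    rw [D.mem_separatingSet_iff R hx hxR hH]
    refine ⟨fun h y hy => ?_, fun h => ?_⟩
    · have := A.inner_mul_pos_of_mem_interior R hH (D.mem_orthogonal H hH)
        (D.vec_ne_zero hH) hxR hy
      rw [real_inner_comm]
      exact (mul_pos_iff_of_pos_left h).mp this
    · rw [real_inner_comm]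
      exact h x hxR

theorem ZonotopalData.separatingSet_eq {A : Arrangement n} {B : A.Region} {d : ℕ}
    (D : A.ZonotopalData B d) (R : A.Region) {x : EuclideanSpace ℝ (Fin n)}
    (hx : x ∈ A.complement) (hxR : x ∈ interior R.1) :
    A.separatingSet R B = A.hyperplanes.filter fun H => 0 < inner ℝ (D.vec H) x := by
  ext H
  rw [Finset.mem_filter]
  refine ⟨fun h => ?_, fun h => (D.mem_separatingSet_iff R hx hxR h.1).mpr h.2⟩
  have hH := A.mem_of_mem_separatingSet h
  exact ⟨hH, (D.mem_separatingSet_iff R hx hxR hH).mp h⟩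

theorem ZonotopalData.exists_isZonotopalEmbedding {A : Arrangement n} {B : A.Region} {d : ℕ}
    (D : A.ZonotopalData B d) (hd : A.rank = d) :
    ∃ (N : A.NormalVectors B) (b : Module.Basis (Fin d) ℝ A.Span), IsZonotopalEmbedding N b := by
  let f : A.Span →ₗ[ℝ] (Fin d → ℝ) :=
    LinearMap.pi fun i => (innerₛₗ ℝ (D.p i)).comp A.Span.subtype
  have hfi : ∀ v i, f v i = inner ℝ (D.p i) (v : EuclideanSpace ℝ (Fin n)) := fun v i => rfl
  have hf : Function.Injective f := by
    refine (injective_iff_map_eq_zero f).mpr fun v hv => Subtype.ext ?_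
    exact D.eq_zero v v.2 fun i => by rw [← hfi, hv, Pi.zero_apply]
  -- Injectivity and equal dimension make the functionals `⟪p i, ·⟫` a full coordinate system; the
  -- required basis is the one dual to it.
  let e : A.Span ≃ₗ[ℝ] (Fin d → ℝ) := LinearEquiv.ofInjectiveOfFinrankEq f hf
    (by rw [Module.finrank_fin_fun]; exact hd)
  refine ⟨D.normalVectors, Module.Basis.ofEquivFun e, fun R₁ R₂ => ?_⟩
  have hZ : ∀ (R : A.RegionPoset B) (i : Fin d),
      (Module.Basis.ofEquivFun e).repr (D.normalVectors.Z R) i =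
        ∑ H ∈ A.separatingSet R B, inner ℝ (D.p i) (D.vec H) := by
    intro R i
    rw [Module.Basis.ofEquivFun_repr_apply]
    change inner ℝ (D.p i) (∑ H ∈ A.separatingSet R B, D.vec H) = _
    rw [inner_sum]
  simp only [hZ]
  constructor
  · intro h i
    exact Finset.sum_le_sum_of_subset_of_nonneg h fun H hH _ =>
      D.nonneg H (A.mem_of_mem_separatingSet hH) i
  · intro h
    obtain ⟨x, hx, hxR⟩ := A.exists_mem_interior R₁
    obtain ⟨y, hy, hyR⟩ := A.exists_mem_interior R₂
    change A.separatingSet R₁ B ⊆ A.separatingSet R₂ B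
    rw [D.separatingSet_eq R₁ hx hxR, D.separatingSet_eq R₂ hy hyR] at *
    intro H hH
    rw [Finset.mem_filter] at hH ⊢
    exact ⟨hH.1, D.reflects x hx y hy h H hH.1 hH.2⟩

/-! ### Adding hyperplanes transverse to a direction -/

/-- Weights each exceeding the sum of all weights further along. -/
theorem exists_dominating_weights {ι : Type*} (s : Finset ι) (t : ι → ℝ) :
    ∃ w : ι → ℝ, (∀ i, 0 < w i) ∧ ∀ i ∈ s, ∑ j ∈ s with t i < t j, w j < w i := by
  -- The exponent counts the indices further along, so it drops strictly with each step. At most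
  -- `s.card` terms are summed, which the base `s.card + 1` beats.
  let c : ι → ℕ := fun i => (s.filter fun j => t i < t j).card
  refine ⟨fun i => ((s.card : ℝ) + 1) ^ c i, fun i => by positivity, fun i hi => ?_⟩
  have hm : (1 : ℝ) ≤ (s.card : ℝ) + 1 := by
    have : (0 : ℝ) ≤ s.card := Nat.cast_nonneg _
    linarith
  rcases Nat.eq_zero_or_pos (c i) with h0 | hpos
  · rw [Finset.card_eq_zero.mp h0, Finset.sum_empty]
    positivity
  · have hle : ∀ j ∈ s.filter (fun j => t i < t j),
        ((s.card : ℝ) + 1) ^ c j ≤ ((s.card : ℝ) + 1) ^ (c i - 1) := by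
      intro j hj
      have hj' := Finset.mem_filter.mp hj
      refine pow_le_pow_right₀ hm (Nat.le_sub_one_of_lt (Finset.card_lt_card ?_))
      refine Finset.ssubset_iff_of_subset (fun k hk => ?_) |>.mpr ⟨j, hj, by simp⟩
      have hk' := Finset.mem_filter.mp hk
      exact Finset.mem_filter.mpr ⟨hk'.1, hj'.2.trans hk'.2⟩
    have hcard : ((s.filter fun j => t i < t j).card : ℝ) ≤ s.card := by
      exact_mod_cast Finset.card_filter_le _ _
    have hp : (0 : ℝ) < ((s.card : ℝ) + 1) ^ (c i - 1) := by positivity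
    calc _ ≤ (s.filter fun j => t i < t j).card • ((s.card : ℝ) + 1) ^ (c i - 1) :=
          Finset.sum_le_card_nsmul _ _ _ hle
      _ < ((s.card : ℝ) + 1) * ((s.card : ℝ) + 1) ^ (c i - 1) := by
          rw [nsmul_eq_mul]
          nlinarith
      _ = ((s.card : ℝ) + 1) ^ c i := by
          rw [← pow_succ', Nat.sub_add_cancel hpos]

/-- After cancelling `S ∩ T`, any one element of `S \ T` precedes all of `T \ S` and so outweighs
it. -/
theorem sum_lt_sum_of_dominating {ι : Type*} [DecidableEq ι] {s S T : Finset ι} {t w : ι → ℝ}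
    (hw : ∀ i, 0 < w i) (hdom : ∀ i ∈ s, ∑ j ∈ s with t i < t j, w j < w i) (hS : S ⊆ s)
    (hT : T ⊆ s) (hlt : ∀ i ∈ S \ T, ∀ j ∈ T \ S, t i < t j) (h : ¬ S ⊆ T) :
    ∑ j ∈ T, w j < ∑ j ∈ S, w j := by
  obtain ⟨i, hiS, hiT⟩ := Finset.not_subset.mp h
  have hi : i ∈ S \ T := Finset.mem_sdiff.mpr ⟨hiS, hiT⟩
  have h1 : ∑ j ∈ T \ S, w j ≤ ∑ j ∈ s with t i < t j, w j :=
    Finset.sum_le_sum_of_subset_of_nonneg (fun j hj => Finset.mem_filter.mpr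
      ⟨hT (Finset.mem_sdiff.mp hj).1, hlt i hi j hj⟩) fun j _ _ => (hw j).le
  have h2 : w i ≤ ∑ j ∈ S \ T, w j :=
    Finset.single_le_sum (f := w) (fun j _ => (hw j).le) hi
  have h3 := hdom i (hS hiS)
  rw [← Finset.sum_inter_add_sum_sdiff S T, ← Finset.sum_inter_add_sum_sdiff T S,
    Finset.inter_comm T S]
  linarith

/-- A uniform gap between the subset sums of finitely many real functions. -/
theorem exists_pos_subset_sum_gap {ι κ : Type*} [Finite κ] (s : Finset ι) (f : κ → ι → ℝ)
    (C : κ → ℝ) : ∃ ε : ℝ, 0 < ε ∧ ∀ k, ∀ S ⊆ s, ∀ T ⊆ s,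
      ∑ i ∈ T, f k i < ∑ i ∈ S, f k i → ∑ i ∈ T, f k i + ε * C k < ∑ i ∈ S, f k i := by
  -- Only finitely many strict inequalities are involved, and each survives a small perturbation.
  have hev : ∀ᶠ ε in nhdsWithin (0 : ℝ) (Set.Ioi 0), ∀ k, ∀ S ∈ s.powerset, ∀ T ∈ s.powerset,
      ∑ i ∈ T, f k i < ∑ i ∈ S, f k i → ∑ i ∈ T, f k i + ε * C k < ∑ i ∈ S, f k i := by
    refine Filter.eventually_all.mpr fun k => (Filter.eventually_all_finset _).mpr fun S _ =>
      (Filter.eventually_all_finset _).mpr fun T _ => ?_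
    by_cases h : ∑ i ∈ T, f k i < ∑ i ∈ S, f k i
    · have hc : Filter.Tendsto (fun ε : ℝ => ∑ i ∈ T, f k i + ε * C k) (nhds 0)
          (nhds (∑ i ∈ T, f k i + 0 * C k)) := Continuous.tendsto (by fun_prop) 0
      rw [zero_mul, add_zero] at hc
      filter_upwards [(hc.mono_left nhdsWithin_le_nhds).eventually_lt_const h] with ε hε _
      exact hε
    · exact Filter.Eventually.of_forall fun _ h' => absurd h' h
  obtain ⟨ε, hε, h0⟩ := (hev.and self_mem_nhdsWithin).exists
  exact ⟨ε, h0, fun k S hS T hT =>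
    hε k S (Finset.mem_powerset.mpr hS) T (Finset.mem_powerset.mpr hT)⟩

/-! ### Subarrangements of rank one less -/

theorem exists_ne_zero_mem_orthogonal (A : Arrangement n)
    {H : Submodule ℝ (EuclideanSpace ℝ (Fin n))} (hH : H ∈ A.hyperplanes) :
    ∃ v ∈ Hᗮ, v ≠ 0 := by
  refine Submodule.exists_mem_ne_zero_of_ne_bot fun hbot => ?_
  have := A.finrank_orthogonal hH
  rw [hbot, finrank_bot] at this
  omega

/-- The part of the span of `A` orthogonal to `u` is the span of `A₀`. -/
theorem mem_Span_of_inner_eq_zero {A A₀ : Arrangement n} (hsub : A₀.hyperplanes ⊆ A.hyperplanes)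
    (hrank : A₀.rank + 1 = A.rank) {u : EuclideanSpace ℝ (Fin n)}
    (hu₀ : ∀ H ∈ A₀.hyperplanes, ∀ v ∈ Hᗮ, inner ℝ u v = 0)
    (hu : ∃ v ∈ A.Span, inner ℝ u v ≠ 0) {v : EuclideanSpace ℝ (Fin n)} (hv : v ∈ A.Span)
    (huv : inner ℝ u v = 0) : v ∈ A₀.Span := by
  -- The right side is a proper subspace of `A.Span`, so its dimension is at most that of `A₀.Span`,
  -- and the two coincide.
  have hle : A₀.Span ≤ A.Span ⊓ (Submodule.span ℝ {u})ᗮ := by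
    refine le_inf (Span_mono hsub) (Submodule.span_le.mpr ?_)
    rintro w ⟨H, hH, hw⟩
    exact Submodule.mem_orthogonal_singleton_iff_inner_right.mpr (hu₀ H hH w hw)
  have hlt : A.Span ⊓ (Submodule.span ℝ {u})ᗮ < A.Span := by
    obtain ⟨w, hw, huw⟩ := hu
    refine lt_of_le_of_ne inf_le_left fun h => huw ?_
    rw [← h] at hw
    exact Submodule.mem_orthogonal_singleton_iff_inner_right.mp hw.2
  have hfin := Submodule.finrank_lt_finrank_of_lt hlt
  have heq := Submodule.eq_of_le_of_finrank_le hle (by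
    change _ ≤ A₀.rank
    change _ < A.rank at hfin
    omega)
  rw [heq]
  exact ⟨hv, Submodule.mem_orthogonal_singleton_iff_inner_right.mpr huv⟩

theorem exists_mem_not_mem_of_rank {A A₀ : Arrangement n}
    (hrank : A₀.rank + 1 = A.rank) :
    ∃ H ∈ A.hyperplanes, H ∉ A₀.hyperplanes ∧ ∃ v ∈ Hᗮ, v ∉ A₀.Span := by
  by_contra! h
  have hle : A.Span ≤ A₀.Span := by
    refine Submodule.span_le.mpr ?_
    rintro w ⟨H, hH, hw⟩
    by_cases hH₀ : H ∈ A₀.hyperplanes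
    · exact A₀.mem_Span hH₀ hw
    · exact h H hH hH₀ w hw
  have := Submodule.finrank_mono hle
  change A.rank ≤ A₀.rank at this
  omega

open Classical in
/-- If the hyperplanes of `A` outside `A₀` are crossed in the same sense by a direction `u` along
`A₀`, and their pairwise intersections lie in members of `A₀`, then the data extends. -/
theorem ZonotopalData.extend {A A₀ : Arrangement n} (hsub : A₀.hyperplanes ⊆ A.hyperplanes)
    (hrank : A₀.rank + 1 = A.rank) {B : A.Region} {B₀ : A₀.Region} (hB : B.1 ⊆ B₀.1)
    {x₀ : EuclideanSpace ℝ (Fin n)} (hx₀ : x₀ ∈ A.complement) (hx₀B : x₀ ∈ interior B.1)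
    {u : EuclideanSpace ℝ (Fin n)} (hu₀ : ∀ H ∈ A₀.hyperplanes, ∀ v ∈ Hᗮ, inner ℝ u v = 0)
    (hu₁ : ∀ H ∈ A.hyperplanes, H ∉ A₀.hyperplanes → ∀ v ∈ Hᗮ, inner ℝ v x₀ < 0 →
      0 < inner ℝ u v)
    (hinf : ∀ H' ∈ A.hyperplanes, H' ∉ A₀.hyperplanes → ∀ H'' ∈ A.hyperplanes,
      H'' ∉ A₀.hyperplanes → H' ≠ H'' → ∃ H ∈ A₀.hyperplanes, H' ⊓ H'' ≤ H)
    {d : ℕ} (D : A₀.ZonotopalData B₀ d) : Nonempty (A.ZonotopalData B (d + 1)) := by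
  let A₁ := A.hyperplanes.filter (· ∉ A₀.hyperplanes)
  have hA₁ : ∀ H, H ∈ A₁ ↔ H ∈ A.hyperplanes ∧ H ∉ A₀.hyperplanes := fun H => Finset.mem_filter
  -- With this normalisation `x₀ + t • u` meets `H` exactly at `t = -⟪m H, x₀⟫ > 0`, the parameter
  -- that orders the weights below.
  have hm : ∀ H, H ∈ A₁ → ∃ v ∈ Hᗮ, inner ℝ u v = 1 ∧ inner ℝ v x₀ < 0 := by
    intro H hH
    obtain ⟨hHA, hHA₀⟩ := (hA₁ H).mp hH
    obtain ⟨v, hv, hvx⟩ := A.exists_normal_inner_eq_neg_one hHA hx₀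
    have hpos := hu₁ H hHA hHA₀ v hv (by linarith)
    refine ⟨(inner ℝ u v)⁻¹ • v, Submodule.smul_mem _ _ hv, ?_, ?_⟩
    · rw [real_inner_smul_right, inv_mul_cancel₀ hpos.ne']
    · rw [real_inner_smul_left, hvx]
      have := inv_pos.mpr hpos
      linarith
  choose! m hmH hmu hmx using hm
  have hm0 : ∀ H ∈ A₁, m H ≠ 0 := fun H hH h => by
    have := hmx H hH
    simp [h] at this
  obtain ⟨w, hw, hdom⟩ := exists_dominating_weights A₁ fun H => -inner ℝ (m H) x₀
  -- Adding `M • u` to `p i` raises its value on each `m H` by `M`, enough for nonnegativity on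
  -- `A₁`, and changes nothing on `A₀.Span`.
  obtain ⟨M, hM⟩ := (Set.finite_range fun k : Fin d × A₁ =>
    -inner ℝ (D.p k.1) (m k.2)).bddAbove
  let q : Fin d → EuclideanSpace ℝ (Fin n) := fun i => D.p i + M • u
  have hqu : ∀ i v, inner ℝ (q i) v = inner ℝ (D.p i) v + M * inner ℝ u v := fun i v => by
    rw [inner_add_left, real_inner_smul_left]
  have hq₀ : ∀ i, ∀ H ∈ A₀.hyperplanes, inner ℝ (q i) (D.vec H) = inner ℝ (D.p i) (D.vec H) := by
    intro i H hH
    rw [hqu, hu₀ H hH _ (D.mem_orthogonal H hH), mul_zero, add_zero]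
  have hq₁ : ∀ i, ∀ H ∈ A₁, 0 ≤ w H * inner ℝ (q i) (m H) := by
    intro i H hH
    have := hM ⟨(i, ⟨H, hH⟩), rfl⟩
    simp only at this
    refine mul_nonneg (hw H).le ?_
    rw [hqu, hmu H hH]
    linarith
  -- The constant for `i` is the largest contribution `A₁` can make to that coordinate before
  -- scaling by `ε`; it must not undo a strict inequality between `A₀`-sums.
  obtain ⟨ε, hε, hgap⟩ := exists_pos_subset_sum_gap A₀.hyperplanes
    (fun (i : Fin d) H => inner ℝ (D.p i) (D.vec H))
    (fun i => ∑ H ∈ A₁, w H * inner ℝ (q i) (m H))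
  let vec : Submodule ℝ (EuclideanSpace ℝ (Fin n)) → EuclideanSpace ℝ (Fin n) := fun H =>
    if H ∈ A₀.hyperplanes then D.vec H else (ε * w H) • m H
  have hvec₀ : ∀ H ∈ A₀.hyperplanes, vec H = D.vec H := fun H hH => if_pos hH
  have hvec₁ : ∀ H ∈ A₁, vec H = (ε * w H) • m H := fun H hH => if_neg ((hA₁ H).mp hH).2
  have hεw : ∀ H, 0 < ε * w H := fun H => mul_pos hε (hw H)
  have hcases : ∀ H ∈ A.hyperplanes, H ∈ A₀.hyperplanes ∨ H ∈ A₁ := fun H hH =>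
    (Classical.em (H ∈ A₀.hyperplanes)).imp_right fun h => (hA₁ H).mpr ⟨hH, h⟩
  have hsum : ∀ (p z : EuclideanSpace ℝ (Fin n)),
      ∑ H ∈ A.hyperplanes with 0 < inner ℝ (vec H) z, inner ℝ p (vec H) =
        ∑ H ∈ A₀.hyperplanes with 0 < inner ℝ (D.vec H) z, inner ℝ p (D.vec H) +
          ε * ∑ H ∈ A₁ with 0 < inner ℝ (m H) z, w H * inner ℝ p (m H) := by
    intro p z
    have hA : A.hyperplanes = A₀.hyperplanes ∪ A₁ := by
      ext H
      rw [Finset.mem_union, hA₁]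
      exact ⟨fun h => (Classical.em _).imp_right fun h' => ⟨h, h'⟩, fun h => h.elim (@hsub H) And.left⟩
    have hdisj : Disjoint A₀.hyperplanes A₁ :=
      Finset.disjoint_left.mpr fun H h h' => ((hA₁ H).mp h').2 h
    rw [Finset.sum_filter, Finset.sum_filter, Finset.sum_filter, hA, Finset.sum_union hdisj,
      Finset.mul_sum]
    congr 1
    · exact Finset.sum_congr rfl fun H hH => by rw [hvec₀ H hH]
    · refine Finset.sum_congr rfl fun H hH => ?_
      rw [hvec₁ H hH, real_inner_smul_left, real_inner_smul_right, mul_ite, mul_zero,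
        ← mul_assoc ε (w H)]
      exact if_congr (mul_pos_iff_of_pos_left (hεw H)) rfl rfl
  refine ⟨⟨vec, Fin.cons u q, fun H hH => ?_, fun H hH x hx => ?_, fun H hH i => ?_,
    fun v hv h => ?_, fun x hx y hy h => ?_⟩⟩
  · rcases hcases H hH with h | h
    · rw [hvec₀ H h]
      exact D.mem_orthogonal H h
    · rw [hvec₁ H h]
      exact Submodule.smul_mem _ _ (hmH H h)
  · rcases hcases H hH with h | h
    · rw [hvec₀ H h]
      exact D.neg_on_base H h x (interior_mono hB hx)
    · rw [hvec₁ H h, real_inner_smul_left]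
      refine mul_neg_of_pos_of_neg (hεw H) ?_
      have := A.inner_mul_pos_of_mem_interior B hH (hmH H h) (hm0 H h) hx₀B hx
      by_contra! hpos
      exact absurd this (not_lt.mpr (mul_nonpos_of_nonpos_of_nonneg (hmx H h).le hpos))
  · rcases hcases H hH with h | h
    · rw [hvec₀ H h]
      refine Fin.cases ?_ (fun i => ?_) i
      · exact (hu₀ H h _ (D.mem_orthogonal H h)).ge
      · rw [Fin.cons_succ, hq₀ i H h]
        exact D.nonneg H h i
    · rw [hvec₁ H h, real_inner_smul_right]
      refine Fin.cases ?_ (fun i => ?_) i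
      · rw [Fin.cons_zero, hmu H h, mul_one]
        exact (hεw H).le
      · rw [Fin.cons_succ, mul_assoc]
        exact mul_nonneg hε.le (hq₁ i H h)
  · have huv : inner ℝ u v = 0 := h 0
    obtain ⟨H, hHA, hHA₀, -⟩ := exists_mem_not_mem_of_rank hrank
    have hH := (hA₁ H).mpr ⟨hHA, hHA₀⟩
    refine D.eq_zero v (mem_Span_of_inner_eq_zero hsub hrank hu₀
      ⟨m H, A.mem_Span hHA (hmH H hH), by rw [hmu H hH]; exact one_ne_zero⟩ hv huv) fun i => ?_
    have := h i.succ
    rwa [Fin.cons_succ, hqu, huv, mul_zero, add_zero] at this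
  · simp only [hsum] at h
    have hrefl₀ := D.reflects x (complement_anti hsub hx) y (complement_anti hsub hy) fun i => by
      by_contra! hlt
      have h1 := h i.succ
      rw [Fin.cons_succ,
        Finset.sum_congr rfl fun H hH => hq₀ i H (Finset.mem_filter.mp hH).1,
        Finset.sum_congr (s₁ := A₀.hyperplanes.filter fun H => 0 < inner ℝ (D.vec H) y) rfl
          fun H hH => hq₀ i H (Finset.mem_filter.mp hH).1] at h1
      have h2 := hgap i _ (Finset.filter_subset _ _) _ (Finset.filter_subset _ _) hlt
      have h3 : 0 ≤ ∑ H ∈ A₁ with 0 < inner ℝ (m H) x, w H * inner ℝ (q i) (m H) :=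
        Finset.sum_nonneg fun H hH => hq₁ i H (Finset.mem_filter.mp hH).1
      have h4 : ∑ H ∈ A₁ with 0 < inner ℝ (m H) y, w H * inner ℝ (q i) (m H) ≤
          ∑ H ∈ A₁, w H * inner ℝ (q i) (m H) :=
        Finset.sum_le_sum_of_subset_of_nonneg (Finset.filter_subset _ _)
          fun H hH _ => hq₁ i H hH
      have h5 := mul_nonneg hε.le h3
      have h6 := mul_le_mul_of_nonneg_left h4 hε.le
      linarith
    have hrefl₁ : (A₁.filter fun H => 0 < inner ℝ (m H) x) ⊆
        A₁.filter fun H => 0 < inner ℝ (m H) y := by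
      by_contra hnot
      have hlt := sum_lt_sum_of_dominating hw hdom (Finset.filter_subset _ _)
        (Finset.filter_subset _ _) ?_ hnot
      · have h1 := h 0
        rw [Fin.cons_zero,
          Finset.sum_eq_zero fun H hH => hu₀ H (Finset.mem_filter.mp hH).1 _
            (D.mem_orthogonal H (Finset.mem_filter.mp hH).1),
          Finset.sum_eq_zero fun H hH => hu₀ H (Finset.mem_filter.mp hH).1 _
            (D.mem_orthogonal H (Finset.mem_filter.mp hH).1), zero_add, zero_add,
          Finset.sum_congr rfl fun H hH => by rw [hmu H (Finset.mem_filter.mp hH).1, mul_one],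
          Finset.sum_congr (s₁ := A₁.filter fun H => 0 < inner ℝ (m H) y) rfl
            fun H hH => by rw [hmu H (Finset.mem_filter.mp hH).1, mul_one]] at h1
        exact absurd (le_of_mul_le_mul_left h1 hε) (not_le.mpr hlt)
      · intro i hi j hj
        simp only [Finset.mem_sdiff, Finset.mem_filter, not_and, not_lt] at hi hj
        obtain ⟨⟨hi, hix⟩, hiy⟩ := hi
        obtain ⟨⟨hj, hjy⟩, hjx⟩ := hj
        have hiy := hiy hi
        have hjx := hjx hj
        have hij : i ≠ j := by
          rintro rfl
          linarith
        -- The normal of `H` is orthogonal to `u`, hence equals `a • (m i - m j)`. The difference `m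
        -- i - m j` is positive at `x` and negative at `y`.
        obtain ⟨H, hH, hle⟩ := hinf i ((hA₁ i).mp hi).1 ((hA₁ i).mp hi).2 j ((hA₁ j).mp hj).1
          ((hA₁ j).mp hj).2 hij
        obtain ⟨a, b, hab⟩ := A.exists_combination_of_inf_le ((hA₁ i).mp hi).1 ((hA₁ j).mp hj).1
          hle (D.mem_orthogonal H hH) (hmH i hi) (hm0 i hi) (hmH j hj) (hm0 j hj)
        have hinner : ∀ z, inner ℝ (D.vec H) z = a * inner ℝ (m i) z + b * inner ℝ (m j) z := by
          intro z
          rw [← hab, inner_add_left, real_inner_smul_left, real_inner_smul_left]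
        have hba : b = -a := by
          have h0 := hu₀ H hH _ (D.mem_orthogonal H hH)
          rw [real_inner_comm, hinner, real_inner_comm, hmu i hi, real_inner_comm, hmu j hj] at h0
          linarith
        subst hba
        have hbase := D.neg_on_base H hH x₀ (interior_mono hB hx₀B)
        rw [hinner] at hbase
        have hxy := hrefl₀ H hH
        rw [hinner, hinner] at hxy
        -- If `a > 0`, then `H` would separate `x` but not `y` from the base, against `hrefl₀`. With
        -- `a < 0`, negativity of the normal at `x₀` says that `i` is met before `j`.
        have ha : a ≤ 0 := by
          by_contra! ha
          have := hxy (by nlinarith)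
          nlinarith
        have ha' : a < 0 := lt_of_le_of_ne ha (by rintro rfl; simp at hbase)
        nlinarith
    intro H hH
    rcases hcases H hH with hH' | hH'
    · rw [hvec₀ H hH']
      exact hrefl₀ H hH'
    · rw [hvec₁ H hH', real_inner_smul_left, real_inner_smul_left,
        mul_pos_iff_of_pos_left (hεw H), mul_pos_iff_of_pos_left (hεw H)]
      exact fun hpos => (Finset.mem_filter.mp (hrefl₁ (Finset.mem_filter.mpr ⟨hH', hpos⟩))).2

/-! ### Arrangements of rank one and two -/

theorem orthogonal_eq_Span_of_rank_eq_one (A : Arrangement n) (h : A.rank = 1)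
    {H : Submodule ℝ (EuclideanSpace ℝ (Fin n))} (hH : H ∈ A.hyperplanes) : Hᗮ = A.Span :=
  Submodule.eq_of_le_of_finrank_eq (fun _ hv => A.mem_Span hH hv)
    ((A.finrank_orthogonal hH).trans h.symm)

/-- One vector `v` is normal to every hyperplane, so each separating set is everything or empty, and
the single coordinate `⟪v, ·⟫` tells these apart. -/
theorem nonempty_zonotopalData_of_rank_eq_one (A : Arrangement n) (h : A.rank = 1)
    (B : A.Region) : Nonempty (A.ZonotopalData B 1) := by
  obtain ⟨H, hH⟩ := A.nonempty
  obtain ⟨b, hb, hbB⟩ := A.exists_mem_interior B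
  obtain ⟨v, hv, hvb⟩ := A.exists_normal_inner_eq_neg_one hH hb
  have hv0 : v ≠ 0 := by
    rintro rfl
    simp at hvb
  have hvv : 0 < inner ℝ v v := real_inner_self_pos.mpr hv0
  have hspan : ∀ w ∈ A.Span, ∃ c : ℝ, c • v = w := fun w hw =>
    A.exists_smul_eq_of_mem_orthogonal hH hv hv0
      (by rwa [A.orthogonal_eq_Span_of_rank_eq_one h hH])
  have horth : ∀ H' ∈ A.hyperplanes, v ∈ H'ᗮ := fun H' hH' => by
    rw [A.orthogonal_eq_Span_of_rank_eq_one h hH']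
    exact A.mem_Span hH hv
  refine ⟨⟨fun _ => v, fun _ => v, horth, fun H' hH' x hx => ?_, fun _ _ _ => hvv.le,
    fun w hw h0 => ?_, fun x _ y _ hxy H' _ hpos => ?_⟩⟩
  · have := A.inner_mul_pos_of_mem_interior B hH hv hv0 hbB hx
    rw [hvb] at this
    linarith
  · obtain ⟨c, rfl⟩ := hspan w hw
    have := h0 0
    rw [real_inner_smul_right] at this
    rw [(mul_eq_zero.mp this).resolve_right hvv.ne', zero_smul]
  · by_contra hy
    have hlt := hxy 0
    rw [Finset.filter_true_of_mem fun _ _ => hpos, Finset.filter_false_of_mem fun _ _ => hy,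
      Finset.sum_empty] at hlt
    exact absurd hlt (not_le.mpr (Finset.sum_pos (fun _ _ => hvv) A.nonempty))

/-- The arrangement consisting of a single member of `A`. -/
def single (A : Arrangement n) {H : Submodule ℝ (EuclideanSpace ℝ (Fin n))}
    (hH : H ∈ A.hyperplanes) : Arrangement n where
  hyperplanes := {H}
  nonempty := Finset.singleton_nonempty H
  codim_one H' hH' := by
    rw [Finset.mem_singleton.mp hH']
    exact A.codim_one H hH

theorem rank_single (A : Arrangement n) {H : Submodule ℝ (EuclideanSpace ℝ (Fin n))}
    (hH : H ∈ A.hyperplanes) : (A.single hH).rank = 1 := by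
  have : (A.single hH).Span = Hᗮ := by
    refine le_antisymm (Submodule.span_le.mpr ?_)
      fun v hv => (A.single hH).mem_Span (Finset.mem_singleton_self H) hv
    rintro v ⟨H', hH', hv⟩
    rwa [Finset.mem_singleton.mp hH'] at hv
  rw [rank, this, A.finrank_orthogonal hH]

/-- A region is contained in a region of any subarrangement. -/
theorem exists_region_superset {A A₀ : Arrangement n} (hsub : A₀.hyperplanes ⊆ A.hyperplanes)
    (B : A.Region) : ∃ B₀ : A₀.Region, B.1 ⊆ B₀.1 := by
  obtain ⟨B, x, hx, rfl⟩ := B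
  exact ⟨⟨_, x, complement_anti hsub hx, rfl⟩,
    closure_mono (connectedComponentIn_mono x (complement_anti hsub))⟩

/-- In rank two, there is a line in a wall of the base region that crosses all other hyperplanes
in the same sense. -/
theorem exists_direction_of_rank_eq_two (A : Arrangement n) (h : A.rank = 2)
    {x : EuclideanSpace ℝ (Fin n)} (hx : x ∈ A.complement) :
    ∃ H₀ ∈ A.hyperplanes, ∃ u, (∀ v ∈ H₀ᗮ, inner ℝ u v = 0) ∧
      ∀ H ∈ A.hyperplanes, H ≠ H₀ → ∀ v ∈ Hᗮ, inner ℝ v x < 0 → 0 < inner ℝ u v := by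
  have hm : ∀ H, H ∈ A.hyperplanes → ∃ v ∈ Hᗮ, inner ℝ v x = -1 := fun H hH =>
    A.exists_normal_inner_eq_neg_one hH hx
  choose! m hmH hmx using hm
  have hm0 : ∀ H ∈ A.hyperplanes, m H ≠ 0 := fun H hH h => by
    have := hmx H hH
    simp [h] at this
  let φ : Module.Dual ℝ A.Span := (innerₛₗ ℝ x).comp A.Span.subtype
  have hφ : φ ≠ 0 := by
    obtain ⟨H, hH⟩ := A.nonempty
    intro h0
    have h1 : inner ℝ x (m H) = 0 := LinearMap.congr_fun h0 ⟨m H, A.mem_Span hH (hmH H hH)⟩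
    rw [real_inner_comm, hmx H hH] at h1
    linarith
  -- The normalised normals `m H` lie on the affine line `⟪x, ·⟫ = -1` in the plane `A.Span`, with
  -- direction `y` spanning this kernel. An extreme one along the line belongs to a wall `H₀`.
  have hker : Module.finrank ℝ (LinearMap.ker φ) = 1 := by
    have := Module.Dual.finrank_ker_add_one_of_ne_zero hφ
    change _ = A.rank at this
    omega
  obtain ⟨⟨⟨y, hyA⟩, hy⟩, -, hgen⟩ := finrank_eq_one_iff'.mp hker
  obtain ⟨H₀, hH₀, hmin⟩ := A.hyperplanes.exists_min_image
    (fun H => inner ℝ (m H) y) A.nonempty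
  -- Since `⟪m H, x⟫ = -1`, the multiple of `x` subtracts the minimal value `⟪m H₀, y⟫` from every
  -- `⟪m H, y⟫`.
  let u := y + (inner ℝ (m H₀) y) • x
  have hu : ∀ H ∈ A.hyperplanes, inner ℝ u (m H) =
      inner ℝ (m H) y -
        inner ℝ (m H₀) y := by
    intro H hH
    rw [inner_add_left, real_inner_smul_left, real_inner_comm (m H) x, hmx H hH,
      real_inner_comm]
    ring
  refine ⟨H₀, hH₀, u, fun v hv => ?_, fun H hH hne v hv hvx => ?_⟩
  · obtain ⟨c, rfl⟩ := A.exists_smul_eq_of_mem_orthogonal hH₀ (hmH H₀ hH₀) (hm0 H₀ hH₀) hv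
    rw [real_inner_smul_right, hu H₀ hH₀, sub_self, mul_zero]
  · obtain ⟨c, rfl⟩ := A.exists_smul_eq_of_mem_orthogonal hH (hmH H hH) (hm0 H hH) hv
    rw [real_inner_smul_left, hmx H hH] at hvx
    rw [real_inner_smul_right, hu H hH]
    refine mul_pos (by linarith) (sub_pos.mpr (lt_of_le_of_ne (hmin H hH) fun heq => hne ?_))
    have hmem : m H - m H₀ ∈ A.Span :=
      sub_mem (A.mem_Span hH (hmH H hH)) (A.mem_Span hH₀ (hmH H₀ hH₀))
    have hmem' : (⟨_, hmem⟩ : A.Span) ∈ LinearMap.ker φ := by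
      change inner ℝ x (m H - m H₀) = 0
      rw [real_inner_comm, inner_sub_left, hmx H hH, hmx H₀ hH₀, sub_self]
    obtain ⟨c, hc⟩ := hgen ⟨_, hmem'⟩
    have hc' : c • y = m H - m H₀ :=
      congrArg (fun z : LinearMap.ker φ => z.1.1) hc
    -- If the minimum is also attained at `H`, then `m H - m H₀` is both a multiple of `y` and
    -- orthogonal to it.
    have h0 : inner ℝ (m H - m H₀) (m H - m H₀) = 0 := by
      nth_rw 2 [← hc']
      rw [real_inner_smul_right, inner_sub_left, heq, sub_self, mul_zero]
    have hmm : m H = m H₀ := sub_eq_zero.mp (inner_self_eq_zero.mp h0)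
    exact A.eq_of_mem_orthogonal hH hH₀ (hmH H hH) (hmm ▸ hmH H₀ hH₀) (hm0 H hH)

/-- Extend from `{H₀}`: two distinct hyperplanes have normals spanning `A.Span`, so their
intersection is contained in every member, in particular in `H₀`. -/
theorem nonempty_zonotopalData_of_rank_eq_two (A : Arrangement n) (h : A.rank = 2)
    (B : A.Region) : Nonempty (A.ZonotopalData B 2) := by
  obtain ⟨x, hx, hxB⟩ := A.exists_mem_interior B
  obtain ⟨H₀, hH₀, u, hu₀, hu₁⟩ := A.exists_direction_of_rank_eq_two h hx
  have hmem : ∀ H, H ∈ (A.single hH₀).hyperplanes ↔ H = H₀ := fun H => Finset.mem_singleton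
  have hsub : (A.single hH₀).hyperplanes ⊆ A.hyperplanes := Finset.singleton_subset_iff.mpr hH₀
  obtain ⟨B₀, hB⟩ := exists_region_superset hsub B
  obtain ⟨D⟩ := (A.single hH₀).nonempty_zonotopalData_of_rank_eq_one (A.rank_single hH₀) B₀
  refine D.extend hsub (by rw [A.rank_single, h]) hB hx hxB (u := u) (fun H hH => ?_)
    (fun H hH hne => hu₁ H hH (mt (hmem H).mpr hne)) fun H' hH' _ H'' hH'' _ hne => ?_
  · rw [(hmem H).mp hH]
    exact hu₀
  · refine ⟨H₀, (hmem H₀).mpr rfl, ?_⟩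
    have hlt : H'ᗮ < H'ᗮ ⊔ H''ᗮ := by
      refine lt_of_le_of_ne le_sup_left fun heq => hne ?_
      have hle : H''ᗮ ≤ H'ᗮ := heq ▸ le_sup_right
      obtain ⟨v, hv, hvx⟩ := A.exists_normal_inner_eq_neg_one hH'' hx
      refine A.eq_of_mem_orthogonal hH' hH'' (hle hv) hv ?_
      rintro rfl
      simp at hvx
    have hfin := Submodule.finrank_lt_finrank_of_lt hlt
    rw [A.finrank_orthogonal hH'] at hfin
    have heq : H'ᗮ ⊔ H''ᗮ = A.Span :=
      Submodule.eq_of_le_of_finrank_le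
        (sup_le (fun _ hv => A.mem_Span hH' hv) fun _ hv => A.mem_Span hH'' hv)
        (h.trans_le hfin)
    have hle : H₀ᗮ ≤ H'ᗮ ⊔ H''ᗮ := heq ▸ fun _ hv => A.mem_Span hH₀ hv
    have := Submodule.orthogonal_le hle
    rwa [← Submodule.inf_orthogonal, Submodule.orthogonal_orthogonal,
      Submodule.orthogonal_orthogonal, Submodule.orthogonal_orthogonal] at this

/-! ### Canonical base regions -/

theorem SplitsAs.subset {A A₀ : Arrangement n}
    {A₁ : Finset (Submodule ℝ (EuclideanSpace ℝ (Fin n)))} (h : A.SplitsAs A₀ A₁) :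
    A₀.hyperplanes ⊆ A.hyperplanes := fun H hH => (h.mem_iff H).mpr (Or.inl hH)

theorem SplitsAs.mem_right {A A₀ : Arrangement n}
    {A₁ : Finset (Submodule ℝ (EuclideanSpace ℝ (Fin n)))} (h : A.SplitsAs A₀ A₁)
    {H : Submodule ℝ (EuclideanSpace ℝ (Fin n))} (hH : H ∈ A.hyperplanes)
    (hH₀ : H ∉ A₀.hyperplanes) : H ∈ A₁ := ((h.mem_iff H).mp hH).resolve_left hH₀

theorem SplitsAs.exists_inf_le {A A₀ : Arrangement n}
    {A₁ : Finset (Submodule ℝ (EuclideanSpace ℝ (Fin n)))} (h : A.SplitsAs A₀ A₁)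
    {H' H'' : Submodule ℝ (EuclideanSpace ℝ (Fin n))} (hH' : H' ∈ A.hyperplanes)
    (hH₀' : H' ∉ A₀.hyperplanes) (hH'' : H'' ∈ A.hyperplanes) (hH₀'' : H'' ∉ A₀.hyperplanes)
    (hne : H' ≠ H'') : ∃ H ∈ A₀.hyperplanes, H' ⊓ H'' ≤ H := by
  obtain ⟨H, hH, -⟩ := h.existsUnique H' (h.mem_right hH' hH₀') H'' (h.mem_right hH'' hH₀'') hne
  exact ⟨H, hH.1, hH.2⟩

/-- There is a direction orthogonal to the span of `A₀` and transverse to every hyperplane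
outside `A₀`. -/
theorem SplitsAs.exists_transverse {A A₀ : Arrangement n}
    {A₁ : Finset (Submodule ℝ (EuclideanSpace ℝ (Fin n)))} (h : A.SplitsAs A₀ A₁) :
    ∃ u, (∀ H ∈ A₀.hyperplanes, ∀ v ∈ Hᗮ, inner ℝ u v = 0) ∧
      ∀ H ∈ A.hyperplanes, H ∉ A₀.hyperplanes → ∀ v ∈ Hᗮ, v ≠ 0 → inner ℝ u v ≠ 0 := by
  obtain ⟨H₁, hH₁, hH₁', v₁, hv₁, hv₁'⟩ := exists_mem_not_mem_of_rank h.rank_eq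
  have hv₁0 : v₁ ≠ 0 := fun h0 => hv₁' (h0 ▸ zero_mem _)
  -- The candidate `u` is the component orthogonal to `A₀.Span` of a normal outside that span, so it
  -- is transverse to `H₁` at least.
  obtain ⟨y, hy, u, hu, rfl⟩ := A₀.Span.exists_add_mem_mem_orthogonal v₁
  have hu₀ : ∀ H ∈ A₀.hyperplanes, ∀ v ∈ Hᗮ, inner ℝ u v = 0 := fun H hH v hv =>
    (Submodule.mem_orthogonal' _ _).mp hu v (A₀.mem_Span hH hv)
  have huv₁ : inner ℝ u (y + u) ≠ 0 := by
    rw [inner_add_right, (Submodule.mem_orthogonal' _ _).mp hu y hy, zero_add]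
    intro h0
    rw [inner_self_eq_zero.mp h0, add_zero] at hv₁'
    exact hv₁' hy
  refine ⟨u, hu₀, fun H hH hH₀ v hv hv0 huv => ?_⟩
  have hne : H ≠ H₁ := by
    rintro rfl
    obtain ⟨c, hc⟩ := A.exists_smul_eq_of_mem_orthogonal hH hv hv0 hv₁
    rw [← hc, real_inner_smul_right, huv, mul_zero] at huv₁
    exact huv₁ rfl
  -- Suppose `H` is parallel to `u`. Pairing `v₂ = a • v + b • v₁` with `u` kills `b`, which makes
  -- `H` equal to `H₂ ∈ A₀`.
  obtain ⟨H₂, hH₂, hle⟩ := h.exists_inf_le hH hH₀ hH₁ hH₁' hne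
  obtain ⟨v₂, hv₂, hv₂0⟩ := A₀.exists_ne_zero_mem_orthogonal hH₂
  obtain ⟨a, b, hab⟩ := A.exists_combination_of_inf_le hH hH₁ hle hv₂ hv hv0 hv₁ hv₁0
  have hb : b = 0 := by
    have h0 := hu₀ H₂ hH₂ v₂ hv₂
    rw [← hab, inner_add_right, real_inner_smul_right, real_inner_smul_right, huv, mul_zero,
      zero_add] at h0
    exact (mul_eq_zero.mp h0).resolve_right huv₁
  rw [hb, zero_smul, add_zero] at hab
  have := A.eq_of_mem_orthogonal hH (h.subset hH₂) (hab ▸ Submodule.smul_mem _ a hv) hv₂ hv₂0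
  exact hH₀ (this ▸ hH₂)

/-- For a canonical base region, the direction can be chosen so that a line from the base region
crosses all hyperplanes outside `A₀` on its positive half. -/
theorem SplitsAs.exists_direction {A A₀ : Arrangement n}
    {A₁ : Finset (Submodule ℝ (EuclideanSpace ℝ (Fin n)))} (h : A.SplitsAs A₀ A₁)
    {B : A.Region} {B₀ : A₀.Region} (hB : B.1 ⊆ B₀.1)
    (hchain : ∀ R R' : A.RegionPoset B, R.1 ⊆ B₀.1 → R'.1 ⊆ B₀.1 → R ≤ R' ∨ R' ≤ R)
    {x : EuclideanSpace ℝ (Fin n)} (hx : x ∈ A.complement) (hxB : x ∈ interior B.1) :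
    ∃ u, (∀ H ∈ A₀.hyperplanes, ∀ v ∈ Hᗮ, inner ℝ u v = 0) ∧
      ∀ H ∈ A.hyperplanes, H ∉ A₀.hyperplanes → ∀ v ∈ Hᗮ, inner ℝ v x < 0 → 0 < inner ℝ u v := by
  classical
  obtain ⟨u, hu₀, hu₁⟩ := h.exists_transverse
  have hm : ∀ H, H ∈ A.hyperplanes → ∃ v ∈ Hᗮ, inner ℝ v x = -1 := fun H hH =>
    A.exists_normal_inner_eq_neg_one hH hx
  choose! m hmH hmx using hm
  have hm0 : ∀ H ∈ A.hyperplanes, m H ≠ 0 := fun H hH h => by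
    have := hmx H hH
    simp [h] at this
  -- A point far along a direction parallel to `u` lies in a region inside `B₀`.
  have far : ∀ u', (∀ H ∈ A₀.hyperplanes, ∀ v ∈ Hᗮ, inner ℝ u' v = 0) →
      (∀ H ∈ A.hyperplanes, H ∉ A₀.hyperplanes → inner ℝ u' (m H) ≠ 0) →
      ∃ R : A.RegionPoset B, R.1 ⊆ B₀.1 ∧ ∀ H ∈ A.hyperplanes, H ∉ A₀.hyperplanes →
        (H ∈ A.separatingSet R B ↔ 0 < inner ℝ u' (m H)) := by
    intro u' hu' hne
    -- Beyond all these reciprocals, `t * ⟪u', m H⟫` outweighs `⟪m H, x⟫ = -1` and fixes the sign at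
    -- `z`; the `+ 1` in `t` makes this strict.
    obtain ⟨T, hT⟩ := (A.hyperplanes.finite_toSet.image
      fun H => |inner ℝ u' (m H)|⁻¹).bddAbove
    let t := |T| + 1
    let z := x + t • u'
    have ht : 0 < t := by positivity
    have hz : ∀ v, inner ℝ v z = inner ℝ v x + t * inner ℝ u' v := fun v => by
      rw [inner_add_right, real_inner_smul_right, real_inner_comm v u']
    have hfar : ∀ H ∈ A.hyperplanes, H ∉ A₀.hyperplanes → 1 < t * |inner ℝ u' (m H)| := by
      intro H hH hH₀
      have hpos := abs_pos.mpr (hne H hH hH₀)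
      have h1 : |inner ℝ u' (m H)|⁻¹ < t :=
        (hT ⟨H, hH, rfl⟩).trans_lt ((le_abs_self T).trans_lt (lt_add_one _))
      have h2 := mul_lt_mul_of_pos_right h1 hpos
      rwa [inv_mul_cancel₀ hpos.ne'] at h2
    have hz₀ : ∀ H ∈ A₀.hyperplanes, inner ℝ (m H) z = -1 := fun H hH => by
      rw [hz, hmx H (h.subset hH), hu' H hH _ (hmH H (h.subset hH)), mul_zero, add_zero]
    have hsign : ∀ H ∈ A.hyperplanes, H ∉ A₀.hyperplanes →
        inner ℝ (m H) z ≠ 0 ∧ (0 < inner ℝ (m H) z ↔ 0 < inner ℝ u' (m H)) := by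
      intro H hH hH₀
      have h1 := hfar H hH hH₀
      rw [hz, hmx H hH]
      rcases lt_or_gt_of_ne (hne H hH hH₀) with hn | hp
      · rw [abs_of_neg hn] at h1
        have : t * inner ℝ u' (m H) < 0 := mul_neg_of_pos_of_neg ht hn
        exact ⟨by linarith, fun h' => by linarith, fun h' => by linarith⟩
      · rw [abs_of_pos hp] at h1
        exact ⟨by linarith, fun _ => hp, fun _ => by linarith⟩
    have hzc : z ∈ A.complement := by
      refine A.mem_complement_of_inner_ne_zero fun H hH => ⟨m H, hmH H hH, ?_⟩
      by_cases hH₀ : H ∈ A₀.hyperplanes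
      · rw [hz₀ H hH₀]
        norm_num
      · exact (hsign H hH hH₀).1
    refine ⟨⟨_, z, hzc, rfl⟩, ?_, fun H hH hH₀ => ?_⟩
    · rw [A₀.eq_closure_of_mem_interior B₀ (interior_mono hB hxB),
        A₀.connectedComponentIn_eq_of_inner_mul_pos (x := x) (y := z)]
      · exact closure_mono (connectedComponentIn_mono z (complement_anti h.subset))
      · intro H hH
        refine ⟨m H, hmH H (h.subset hH), ?_⟩
        rw [hz₀ H hH, hmx H (h.subset hH)]
        norm_num
    · refine Finset.mem_filter.trans ?_
      change _ ∧ Separates H (closure (connectedComponentIn A.complement z)) B.1 ↔ _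
      rw [and_iff_right hH, A.eq_closure_of_mem_interior B hxB,
        A.separates_iff hH (hmH H hH)
          (fun w hw => A.exists_smul_eq_of_mem_orthogonal hH (hmH H hH) (hm0 H hH) hw)
          (A.mem_iff_inner_eq_zero hH (hmH H hH) (hm0 H hH)) hzc hx, hmx H hH,
        ← (hsign H hH hH₀).2]
      exact ⟨fun h' => by linarith, fun h' => by linarith⟩
  have hne : ∀ H ∈ A.hyperplanes, H ∉ A₀.hyperplanes → inner ℝ u (m H) ≠ 0 :=
    fun H hH hH₀ => hu₁ H hH hH₀ _ (hmH H hH) (hm0 H hH)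
  have hneg : ∀ H ∈ A₀.hyperplanes, ∀ v ∈ Hᗮ, inner ℝ (-u) v = 0 := fun H hH v hv => by
    rw [inner_neg_left, hu₀ H hH v hv, neg_zero]
  suffices hall : ∃ u', (∀ H ∈ A₀.hyperplanes, ∀ v ∈ Hᗮ, inner ℝ u' v = 0) ∧
      ∀ H ∈ A.hyperplanes, H ∉ A₀.hyperplanes → 0 < inner ℝ u' (m H) by
    obtain ⟨u', hu', hpos⟩ := hall
    refine ⟨u', hu', fun H hH hH₀ v hv hvx => ?_⟩
    obtain ⟨c, rfl⟩ := A.exists_smul_eq_of_mem_orthogonal hH (hmH H hH) (hm0 H hH) hv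
    rw [real_inner_smul_left, hmx H hH] at hvx
    rw [real_inner_smul_right]
    exact mul_pos (by linarith) (hpos H hH hH₀)
  obtain ⟨R, hRB, hR⟩ := far u hu₀ hne
  obtain ⟨R', hRB', hR'⟩ := far (-u) hneg fun H hH hH₀ => by
    rw [inner_neg_left]
    exact neg_ne_zero.mpr (hne H hH hH₀)
  simp only [inner_neg_left, Left.neg_pos_iff] at hR'
  -- Outside `A₀` the two separating sets are complementary, so the smaller one has no element
  -- there.
  rcases hchain R R' hRB hRB' with hle | hle
  · refine ⟨-u, hneg, fun H hH hH₀ => ?_⟩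
    rw [inner_neg_left, Left.neg_pos_iff]
    refine lt_of_le_of_ne (not_lt.mp fun hpos => ?_) (hne H hH hH₀)
    exact lt_asymm hpos ((hR' H hH hH₀).mp (hle ((hR H hH hH₀).mpr hpos)))
  · refine ⟨u, hu₀, fun H hH hH₀ => ?_⟩
    refine lt_of_le_of_ne (not_lt.mp fun hn => ?_) (hne H hH hH₀).symm
    exact lt_asymm hn ((hR H hH hH₀).mp (hle ((hR' H hH hH₀).mpr hn)))

theorem IsCanonical.nonempty_zonotopalData {A : Arrangement n} {B : A.Region}
    (h : A.IsCanonical B) : Nonempty (A.ZonotopalData B A.rank) := by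
  induction h with
  | of_rank_le_two A B h =>
    rcases h with h | h
    · rw [h]
      exact A.nonempty_zonotopalData_of_rank_eq_one h B
    · rw [h]
      exact A.nonempty_zonotopalData_of_rank_eq_two h B
  | of_splitsAs A A₀ A₁ hrank hA₀ hsplit B B₀ hB hB₀ hchain ih =>
    obtain ⟨D⟩ := ih
    obtain ⟨x, hx, hxB⟩ := A.exists_mem_interior B
    obtain ⟨u, hu₀, hu₁⟩ := hsplit.exists_direction hB hchain hx hxB
    rw [← hsplit.rank_eq]
    exact D.extend hsplit.subset hsplit.rank_eq hB hx hxB hu₀ hu₁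
      fun _ hH' hH₀' _ hH'' hH₀'' hne => hsplit.exists_inf_le hH' hH₀' hH'' hH₀'' hne

end Arrangement

theorem mainTheorem6 {n d : ℕ} (A : Arrangement n) (hA : A.IsSupersolvable) (hd : A.rank = d)
    (B : A.Region) (hB : A.IsCanonical B) :
    ∃ (N : A.NormalVectors B) (b : Module.Basis (Fin d) ℝ A.Span),
      Arrangement.IsZonotopalEmbedding N b := by
  subst hd
  obtain ⟨D⟩ := hB.nonempty_zonotopalData
  exact D.exists_isZonotopalEmbedding rfl
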